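/- Let $\mathbb F_q$ be a finite field and let $n,k,\ell,m$ be integers with $k\ge 2$, $d=2k-2\le n-1$, $0\le m\le \ell<k$; put $\alpha=k-1$. **Codes.** A storage code for $n$ nodes with parameters $(\alpha',\beta')$ encodes $B^*$ message symbols and $R$ random symbols from $\mathbb F_q$ into $\alpha'$ symbols per node; for the repair of a failed node $f$ by a set $H$ of helpers, $f\notin H$, $|H|=d$, each helper passes $\beta'$ symbols that are functions of its stored data (and of $f,H$). The code is an $[n,k,d]$ MSR code if $B^*+R=k\alpha'$, $d\beta'=\alpha'+(k-1)\beta'$, the data stored in any $k$ nodes determine all $B^*+R$ input symbols, and the symbols passed by any $d$ helpers determine the data of the failed node. It is $\{\ell,m\}$-secure if, whenever the random symbols are uniform on $\mathbb F_q$, independent of each other and of the message (whose distribution is arbitrary), the mutual information between the message and the view of any eavesdropper is $0$; here the view consists of the data stored in some at most $\ell$ nodes and of all data passed in any number of repair operations of at most $m$ of these nodes. **The code $\mathcal C^*$** ($\beta=1$). Let $\Phi$ be an $n\times\alpha$ matrix and $\Lambda$ an $n\times n$ diagonal matrix over $\mathbb F_q$, and $\Psi^*=[\Phi\ \ \Lambda\Phi]$.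 Call $(\Phi,\Lambda)$ admissible if any $\alpha$ rows of $\Phi$ are linearly independent, any $d$ rows of $\Psi^*$ are linearly independent, the diagonal entries of $\Lambda$ are distinct, and for each $j\in\{\ell,\ \max(\ell-1,0),\ m\}$ any $j$ rows of $\Psi^*$ restricted to its first $j$ columns are linearly independent. Let $S_1^*,S_2^*$ be symmetric $\alpha\times\alpha$ matrices whose $\alpha(\alpha+1)$ free entries are filled as follows: the entries in the first $\ell$ rows (and columns) of $S_1^*$, those in the intersection of the first $\ell-1$ rows and first $\ell-1$ columns of $S_2^*$ (none if $\ell=0$), and those in the first $m$ rows (and columns) of $S_2^*$ are random symbols; all other entries are message symbols. Node $i$ stores the $i$-th row of $\Psi^* M^*$, where $M^*=\begin{bmatrix}S_1^*\\ S_2^*\end{bmatrix}$; to repair node $f$, each helper passes the inner product of its stored data with the $f$-th row of $\Phi$. **Theorem.** 1. $\mathcal C^*$ has $R=\ell\alpha+(k-\ell)m$ random symbols and $B^*=(k-\ell)(\alpha-m)$ message symbols. 2. For every admissible $(\Phi,\Lambda)$, $\mathcal C^*$ is an $[n,k,d]$ MSR code and is $\{\ell,m\}$-secure. 3. If $x_1,\dots,x_n\in\mathbb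 F_q$ have pairwise distinct powers $x_i^{\alpha}$, then the Vandermonde choice $\Phi=(x_i^{c})_{1\le i\le n,\,0\le c<\alpha}$, $\Lambda=\mathrm{diag}(x_1^\alpha,\dots,x_n^\alpha)$ is admissible. 4. If $m\le 1$, every (not necessarily linear) $\{\ell,m\}$-secure $[n,k,d]$ MSR code over $\mathbb F_q$ with parameters $(\alpha',\beta')$ has at most $(k-\ell)(\alpha'-m\beta')$ message symbols; so the message size $B^*$ of $\mathcal C^*$ is optimal. -/

import Mathlib

open MeasureTheory ProbabilityTheory

noncomputable section

namespace SecureMSR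

/-! ### Mutual information -/

/-- Mutual information `I(X;Y)`: the Kullback–Leibler divergence of the joint law of `(X,Y)`
from the product of the marginal laws. -/
def mutualInformation {Ω X Y : Type*} [MeasurableSpace Ω] [MeasurableSpace X]
    [MeasurableSpace Y] (μ : Measure Ω) (f : Ω → X) (g : Ω → Y) : ENNReal :=
  InformationTheory.klDiv (μ.map fun ω => (f ω, g ω)) ((μ.map f).prod (μ.map g))

/-! ### Storage codes with repair -/

/-- A (not necessarily linear) code over the alphabet `A` for `n` nodes that store `α` symbols
each. Its input consists of message symbols, indexed by `ι`, and random symbols, indexed by `ρ`.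
When the failed node `f` is repaired with the help of the nodes in `H`, the helper `j ∈ H`, whose
stored data is `x`, passes the `β` symbols `send f H j x`. -/
structure StorageCode (A ι ρ : Type*) (n α β : ℕ) where
  store : (ι → A) → (ρ → A) → Fin n → (Fin α → A)
  send : Fin n → Finset (Fin n) → Fin n → (Fin α → A) → (Fin β → A)

/-- A repair operation: a failed node and a set of `d` helpers among the remaining nodes. -/
structure RepairOp (n d : ℕ) where
  failed : Fin n
  helpers : Finset (Fin n)
  card_helpers : helpers.card = d
  failed_notMem : failed ∉ helpers

/-- An `{ℓ, m}`-eavesdropper: it reads the data stored in at most `ℓ` nodes, and it listens to a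
sequence of arbitrarily many repair operations of at most `m` of these nodes. -/
structure Eavesdropper (n d ℓ m : ℕ) where
  stored : Finset (Fin n)
  card_stored : stored.card ≤ ℓ
  repaired : Finset (Fin n)
  repaired_subset : repaired ⊆ stored
  card_repaired : repaired.card ≤ m
  numOps : ℕ
  op : Fin numOps → RepairOp n d
  op_failed_mem : ∀ t, (op t).failed ∈ repaired

namespace StorageCode

variable {A ι ρ : Type*} {n α β : ℕ}

/-- All input symbols, message and random ones, are determined by the data stored in any `k`
nodes. -/
def CanReconstruct (C : StorageCode A ι ρ n α β) (k : ℕ) : Prop :=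
  ∀ K : Finset (Fin n), K.card = k → ∀ u u' r r',
    (∀ i ∈ K, C.store u r i = C.store u' r' i) → u = u' ∧ r = r'

/-- The data stored in any failed node is determined by the symbols that any `d` of the remaining
nodes pass to it. -/
def CanRepair (C : StorageCode A ι ρ n α β) (d : ℕ) : Prop :=
  ∀ op : RepairOp n d, ∀ u u' r r',
    (∀ j ∈ op.helpers, C.send op.failed op.helpers j (C.store u r j) =
      C.send op.failed op.helpers j (C.store u' r' j)) →
    C.store u r op.failed = C.store u' r' op.failed

/-- The code is an `[n, k, d]` minimum storage regenerating code: its `B` input symbols (message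
and random symbols together) satisfy `B = kα`, moreover `dβ = α + (k-1)β`, and reconstruction from
any `k` nodes and repair from any `d` nodes are possible. -/
structure IsMSR [Fintype ι] [Fintype ρ] (C : StorageCode A ι ρ n α β) (k d : ℕ) : Prop where
  card_input : Fintype.card ι + Fintype.card ρ = k * α
  repair_bandwidth : d * β = α + (k - 1) * β
  reconstruct : C.CanReconstruct k
  repair : C.CanRepair d

/-- What the eavesdropper sees, when the message is `u` and the random symbols are `r`. -/
def view {d ℓ m : ℕ} (C : StorageCode A ι ρ n α β) (E : Eavesdropper n d ℓ m)
    (u : ι → A) (r : ρ → A) :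
    (E.stored → Fin α → A) × ((t : Fin E.numOps) → (E.op t).helpers → Fin β → A) :=
  (fun i => C.store u r i,
   fun t j => C.send (E.op t).failed (E.op t).helpers j (C.store u r j))

/-- `{ℓ, m}`-security: whatever the distribution `ν` of the message is, if the random symbols are
uniform on `A`, independent of each other and of the message, then no `{ℓ, m}`-eavesdropper gets
any information about the message. -/
def IsSecure [Fintype ρ] [MeasurableSpace A] (C : StorageCode A ι ρ n α β) (d ℓ m : ℕ) : Prop :=
  ∀ (ν : Measure (ι → A)) [IsProbabilityMeasure ν] (E : Eavesdropper n d ℓ m),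
    mutualInformation (ν.prod (Measure.pi fun _ : ρ => uniformOn (Set.univ : Set A)))
      (fun ω => ω.1) (fun ω => C.view E ω.1 ω.2) = 0

end StorageCode

/-! ### The secure product-matrix code for `d = 2k - 2`, `α = k - 1`, `β = 1` -/

/-- The free entries of the two symmetric matrices: `(0, s(i, j))` is the entry of `S₁`, and
`(1, s(i, j))` the entry of `S₂`, in the positions `(i, j)` and `(j, i)`. -/
abbrev Position (α : ℕ) : Type := Fin 2 × Sym2 (Fin α)

/-- The entries that hold random symbols: the first `ℓ` rows and columns of `S₁`; the
intersection of the first `ℓ - 1` rows and the first `ℓ - 1` columns of `S₂`; the first `m` rows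
and columns of `S₂`. All other entries hold message symbols. -/
def randomPositions (α ℓ m : ℕ) : Finset (Position α) :=
  {p | (p.1 = 0 ∧ ∃ i ∈ p.2, i.val < ℓ) ∨
    (p.1 = 1 ∧ ((∀ i ∈ p.2, i.val < ℓ - 1) ∨ ∃ i ∈ p.2, i.val < m))}

/-- The indices of the message symbols. -/
abbrev MessageIndex (α ℓ m : ℕ) : Type := {p : Position α // p ∉ randomPositions α ℓ m}

/-- The indices of the random symbols. -/
abbrev RandomIndex (α ℓ m : ℕ) : Type := {p : Position α // p ∈ randomPositions α ℓ m}

variable {F : Type*}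

/-- The symmetric matrices `S₁` (`s = 0`) and `S₂` (`s = 1`). -/
def symmMatrix {α ℓ m : ℕ} (u : MessageIndex α ℓ m → F) (r : RandomIndex α ℓ m → F) (s : Fin 2) :
    Matrix (Fin α) (Fin α) F :=
  Matrix.of fun i j =>
    if h : (s, s(i, j)) ∈ randomPositions α ℓ m then r ⟨_, h⟩ else u ⟨_, h⟩

/-- The message matrix, `S₁` on top of `S₂`. -/
def messageMatrix {α ℓ m : ℕ} (u : MessageIndex α ℓ m → F) (r : RandomIndex α ℓ m → F) :
    Matrix (Fin α ⊕ Fin α) (Fin α) F :=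
  Matrix.fromRows (symmMatrix u r 0) (symmMatrix u r 1)

/-- The encoding matrix `Ψ = [Φ  ΛΦ]`, where `Λ` is the diagonal matrix with diagonal `lam`. -/
def encodingMatrix [Field F] {n α : ℕ} (Φ : Matrix (Fin n) (Fin α) F) (lam : Fin n → F) :
    Matrix (Fin n) (Fin α ⊕ Fin α) F :=
  Matrix.fromCols Φ (Matrix.diagonal lam * Φ)

/-- Any `j` rows of the matrix are linearly independent. -/
def AnyRowsIndependent [Field F] {n : ℕ} {κ : Type*} (j : ℕ) (A : Matrix (Fin n) κ F) : Prop :=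
  ∀ I : Finset (Fin n), I.card = j → LinearIndependent F fun i : I => A i

/-- The restriction of a matrix to its first `j` columns. -/
def firstColumns {n α : ℕ} (j : ℕ) (A : Matrix (Fin n) (Fin α) F) :
    Matrix (Fin n) {c : Fin α // c.val < j} F :=
  A.submatrix id Subtype.val

/-- The requirements on `Φ` and `Λ = diag(lam)`. The first `j ≤ α` columns of `Ψ` are the first
`j` columns of `Φ`. -/
structure IsAdmissible [Field F] {n α : ℕ} (Φ : Matrix (Fin n) (Fin α) F) (lam : Fin n → F)
    (ℓ m : ℕ) : Prop where
  phi_rows : AnyRowsIndependent α Φ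
  psi_rows : AnyRowsIndependent (2 * α) (encodingMatrix Φ lam)
  lam_injective : Function.Injective lam
  first_ell : AnyRowsIndependent ℓ (firstColumns ℓ Φ)
  first_ell_sub_one : AnyRowsIndependent (ℓ - 1) (firstColumns (ℓ - 1) Φ)
  first_m : AnyRowsIndependent m (firstColumns m Φ)

/-- The secure code: node `i` stores row `i` of `Ψ M`; for the repair of node `f`, each helper
passes the inner product of its stored data with row `f` of `Φ`. -/
def secureCode [Field F] {n α : ℕ} (Φ : Matrix (Fin n) (Fin α) F) (lam : Fin n → F) (ℓ m : ℕ) :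
    StorageCode F (MessageIndex α ℓ m) (RandomIndex α ℓ m) n α 1 where
  store u r i := (encodingMatrix Φ lam * messageMatrix u r) i
  send f _ _ x := fun _ => x ⬝ᵥ Φ f

end SecureMSR

end

namespace SecureMSR

/-! ### The number of message symbols and of random symbols -/

/-! Write φ_i for the rows of `Φ`. If nodes i ≠ j both store zero, the symmetry of `S₁`, `S₂` gives
two equations in φ_jᵀS₁φ_i and φ_jᵀS₂φ_i whose determinant is ±(λ_i - λ_j), so both numbers vanish.
With α other nodes j this forces S₁φ_i = S₂φ_i = 0, whence reconstruction. The repair of f is the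
solution of a square system for the 2α entries of S₁φ_f and S₂φ_f.

Security: everything a maximal eavesdropper sees is a linear function of ℓα + (k-ℓ)m coordinates,
exactly as many as there are random symbols. By `eq_zero_of_observed_eq_zero` these coordinates are
injective in the random symbols, hence bijective, so every message is compatible with the zero view.
Translating the randomness then turns the view for any message into the view for message 0: its law
does not depend on the message.

Bound: security makes every message compatible with one fixed view (`exists_view_eq`). That view
fixes ℓ of k nodes and leaves each of the others at most |A|^(α - mβ) contents; for m = 1 this is
`card_fiber_send_le`. -/

theorem two_mul_card_sym2 {γ : Type*} (s : Finset γ) :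
    2 * s.sym2.card = s.card * (s.card + 1) := by
  rw [Finset.card_sym2, Nat.choose_two_right, Nat.add_sub_cancel, mul_comm (s.card + 1),
    Nat.mul_div_cancel' (Nat.even_mul_succ_self _).two_dvd]

theorem card_filter_fin_le (α a b : ℕ) (hb : b ≤ α) :
    (Finset.univ.filter fun i : Fin α => a ≤ i.val ∧ i.val < b).card = b - a := by
  rw [← Nat.card_Ico a b, ← Finset.card_map Fin.valEmbedding]
  congr 1
  ext i
  simp only [Finset.mem_map, Finset.mem_filter, Finset.mem_univ, true_and, Fin.valEmbedding_apply,
    Finset.mem_Ico]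
  exact ⟨fun ⟨j, hj, h⟩ => h ▸ hj, fun h => ⟨⟨i, by omega⟩, h, rfl⟩⟩

theorem card_messageIndex {α ℓ m : ℕ} (hℓ : ℓ ≤ α) (hm : m ≤ ℓ) :
    Fintype.card (MessageIndex α ℓ m) = (α + 1 - ℓ) * (α - m) := by
  set A := Finset.univ.filter fun i : Fin α => ℓ ≤ i.val ∧ i.val < α
  set B := Finset.univ.filter fun i : Fin α => m ≤ i.val ∧ i.val < α
  set C := Finset.univ.filter fun i : Fin α => m ≤ i.val ∧ i.val < ℓ - 1
  have hCB : C.sym2 ⊆ B.sym2 := Finset.sym2_mono fun i => by simp [B, C]; omega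
  -- In `S₁` both indices are at least ℓ; in `S₂` both are at least m, but not both below ℓ - 1.
  have key : Fintype.card (MessageIndex α ℓ m) = A.sym2.card + (B.sym2 \ C.sym2).card := by
    rw [Fintype.card_subtype,
      ← Finset.card_map (s := A.sym2) ⟨Prod.mk (0 : Fin 2), Prod.mk_right_injective _⟩,
      ← Finset.card_map (s := B.sym2 \ C.sym2) ⟨Prod.mk (1 : Fin 2), Prod.mk_right_injective _⟩,
      ← Finset.card_union_of_disjoint]
    · congr 1
      ext ⟨s, p⟩
      induction p using Sym2.ind with | _ i j =>
      have := i.isLt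
      have := j.isLt
      fin_cases s
      · simp [randomPositions, Finset.mem_sym2_iff, A]
      · simp [randomPositions, Finset.mem_sym2_iff, B, C]
        omega
    · simp only [Finset.disjoint_left, Finset.mem_map]
      rintro _ ⟨p, _, rfl⟩ ⟨q, _, h⟩
      simp at h
  have hA : A.card = α - ℓ := card_filter_fin_le _ _ _ le_rfl
  have hB : B.card = α - m := card_filter_fin_le _ _ _ le_rfl
  have hC : C.card = ℓ - 1 - m := card_filter_fin_le _ _ _ (by omega)
  have h1 := two_mul_card_sym2 A
  have h2 := two_mul_card_sym2 B
  have h3 := two_mul_card_sym2 C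
  have h4 := Finset.card_sdiff_add_card_eq_card hCB
  rw [hA] at h1
  rw [hB] at h2
  rw [hC] at h3
  obtain ⟨b, rfl⟩ := Nat.exists_eq_add_of_le hm
  obtain ⟨a, rfl⟩ := Nat.exists_eq_add_of_le hℓ
  have e1 : m + b + a - (m + b) = a := by omega
  have e2 : m + b + a - m = a + b := by omega
  have e3 : m + b + a + 1 - (m + b) = a + 1 := by omega
  have e4 : m + b - 1 - m = b - 1 := by omega
  rw [e1] at h1
  rw [e2] at h2
  rw [e4] at h3
  rw [key, e2, e3]
  -- Also true for b = 0, that is ℓ = m, under truncated subtraction.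
  have h5 : (b - 1) * (b - 1 + 1) + b = b * b := by
    cases b <;> simp; ring
  nlinarith

theorem card_randomIndex_add_card_messageIndex (α ℓ m : ℕ) :
    Fintype.card (RandomIndex α ℓ m) + Fintype.card (MessageIndex α ℓ m) = α * (α + 1) := by
  rw [Fintype.card_subtype_compl, Nat.add_sub_cancel' (Fintype.card_subtype_le _),
    Fintype.card_prod, Fintype.card_fin, Sym2.card, Fintype.card_fin, ← Fintype.card_fin α,
    ← Finset.card_univ, ← Finset.card_sym2, two_mul_card_sym2]

theorem card_randomIndex {α ℓ m : ℕ} (hℓ : ℓ ≤ α) (hm : m ≤ ℓ) :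
    Fintype.card (RandomIndex α ℓ m) = ℓ * α + (α + 1 - ℓ) * m := by
  have h := card_randomIndex_add_card_messageIndex α ℓ m
  rw [card_messageIndex hℓ hm] at h
  obtain ⟨b, rfl⟩ := Nat.exists_eq_add_of_le hm
  obtain ⟨a, rfl⟩ := Nat.exists_eq_add_of_le hℓ
  have e2 : m + b + a - m = a + b := by omega
  have e3 : m + b + a + 1 - (m + b) = a + 1 := by omega
  rw [e2, e3] at h
  rw [e3]
  nlinarith

/-! ### Independence of rows -/

section Code

variable {F : Type*} [Field F]

/-- As many independent rows as columns span the whole space. -/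
theorem AnyRowsIndependent.eq_zero_of_dotProduct {n j : ℕ} {κ : Type*} [Fintype κ]
    {A : Matrix (Fin n) κ F} (hA : AnyRowsIndependent j A) (hκ : Fintype.card κ = j)
    {I : Finset (Fin n)} (hI : I.card = j) {v : κ → F} (hv : ∀ i ∈ I, v ⬝ᵥ A i = 0) : v = 0 := by
  have hspan := (hA I hI).span_eq_top_of_card_eq_finrank' (by simp [hI, hκ])
  have hle : Submodule.span F (Set.range fun i : I => A i) ≤
      LinearMap.ker (dotProductBilin F F v) := by
    rw [Submodule.span_le]
    rintro _ ⟨i, rfl⟩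
    exact hv i i.2
  rw [hspan] at hle
  exact dotProduct_eq_zero v fun w => hle (Submodule.mem_top : w ∈ _)

theorem eq_zero_of_firstColumns {n α j : ℕ} (hj : j ≤ α) {Φ : Matrix (Fin n) (Fin α) F}
    (hΦ : AnyRowsIndependent j (firstColumns j Φ)) {I : Finset (Fin n)} (hI : I.card = j)
    {v : Fin α → F} (hv : ∀ i ∈ I, v ⬝ᵥ Φ i = 0) (h0 : ∀ c, j ≤ c.val → v c = 0) : v = 0 := by
  have hcard : Fintype.card {c : Fin α // c.val < j} = j := by
    rw [Fintype.card_subtype]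
    simpa using card_filter_fin_le α 0 j hj
  have h := hΦ.eq_zero_of_dotProduct hcard hI (v := fun c => v c) fun i hi => by
    rw [← hv i hi]
    simp only [dotProduct, firstColumns, Matrix.submatrix_apply, id]
    rw [← Fintype.sum_subtype_add_sum_subtype (fun c : Fin α => c.val < j)
      fun c => v c * Φ i c, left_eq_add]
    exact Finset.sum_eq_zero fun c _ => by rw [h0 c (not_lt.1 c.2), zero_mul]
  ext c
  by_cases hc : c.val < j
  · exact congrFun h ⟨c, hc⟩
  · exact h0 c (not_lt.1 hc)

theorem anyRowsIndependent_pow {n j : ℕ} {κ : Type*} {x : Fin n → F} (hx : Function.Injective x)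
    (g : κ ≃ Fin j) {A : Matrix (Fin n) κ F} (hA : ∀ i c, A i c = x i ^ (g c : ℕ)) :
    AnyRowsIndependent j A := by
  intro I hI
  let e : Fin j ≃ I := (finCongr hI.symm).trans I.equivFin.symm
  have hdet : (Matrix.vandermonde fun t => x (e t)).det ≠ 0 :=
    Matrix.det_vandermonde_ne_zero_iff.2
      (hx.comp (Subtype.val_injective.comp e.injective))
  have h := (Matrix.linearIndependent_rows_of_det_ne_zero hdet).map'
    (LinearEquiv.funCongrLeft F F g).toLinearMap (LinearEquiv.ker _)
  rw [← linearIndependent_equiv e]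
  have hcomp : (fun i : I => A i) ∘ e = (LinearEquiv.funCongrLeft F F g).toLinearMap ∘
      (Matrix.vandermonde fun t => x (e t)).row := by
    ext t c
    simp [hA, LinearMap.funLeft, Matrix.vandermonde]
  rw [hcomp]
  exact h

theorem isAdmissible_vandermonde {n α ℓ m : ℕ} (hℓ : ℓ ≤ α) (hm : m ≤ ℓ)
    {x : Fin n → F} (hx : ∀ i j, i ≠ j → x i ^ α ≠ x j ^ α) :
    IsAdmissible (Matrix.of fun i (c : Fin α) => x i ^ (c : ℕ)) (fun i => x i ^ α) ℓ m := by
  have hinj : Function.Injective fun i => x i ^ α := fun i j h => by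
    by_contra hne
    exact hx i j hne h
  have hx' : Function.Injective x := fun i j h => hinj (by simp [h])
  have hfirst : ∀ j ≤ α, AnyRowsIndependent j
      (firstColumns j (Matrix.of fun i (c : Fin α) => x i ^ (c : ℕ))) := fun j hj =>
    anyRowsIndependent_pow hx'
      ⟨fun c => ⟨c.1, c.2⟩, fun t => ⟨⟨t, t.2.trans_le hj⟩, t.2⟩, fun _ => rfl, fun _ => rfl⟩
      fun _ _ => rfl
  refine ⟨anyRowsIndependent_pow hx' (Equiv.refl _) fun _ _ => rfl, ?_, hinj, hfirst _ hℓ,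
    hfirst _ (by omega), hfirst _ (by omega)⟩
  -- Since λ_i = x_i^α, the right half of `Ψ` continues the powers: `Ψ` is itself Vandermonde with
  -- 2α columns.
  refine anyRowsIndependent_pow hx' (finSumFinEquiv.trans (finCongr (two_mul α).symm)) ?_
  rintro i (c | c) <;> simp [encodingMatrix, pow_add, mul_comm]

/-! ### Reconstruction and repair -/

open Matrix in
theorem dotProduct_mulVec_comm_of_isSymm {α : ℕ} {S : Matrix (Fin α) (Fin α) F} (hS : S.IsSymm)
    (v w : Fin α → F) : v ⬝ᵥ S *ᵥ w = w ⬝ᵥ S *ᵥ v := by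
  rw [dotProduct_mulVec, ← mulVec_transpose, hS.eq, dotProduct_comm]

open Matrix in
theorem eq_zero_of_mulVec_eq_zero {n α : ℕ} {Φ : Matrix (Fin n) (Fin α) F}
    (hΦ : AnyRowsIndependent α Φ) {S : Matrix (Fin α) (Fin α) F} {I : Finset (Fin n)}
    (hI : I.card = α) (h : ∀ i ∈ I, S *ᵥ Φ i = 0) : S = 0 := by
  ext c c'
  exact congrFun (hΦ.eq_zero_of_dotProduct (Fintype.card_fin α) hI (v := S c)
    fun i hi => congrFun (h i hi) c) c'

open Matrix in
/-- If `S₁ φ_i + λ_i S₂ φ_i` vanishes for two distinct indices, then so do the corresponding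
off-diagonal entries of both bilinear forms. -/
theorem dotProduct_mulVec_eq_zero {n α : ℕ} {Φ : Matrix (Fin n) (Fin α) F} {lam : Fin n → F}
    (hlam : Function.Injective lam) {S₁ S₂ : Matrix (Fin α) (Fin α) F} (h₁ : S₁.IsSymm)
    (h₂ : S₂.IsSymm) {i j : Fin n} (hij : i ≠ j) (hi : S₁ *ᵥ Φ i + lam i • S₂ *ᵥ Φ i = 0)
    (hj : S₁ *ᵥ Φ j + lam j • S₂ *ᵥ Φ j = 0) :
    Φ j ⬝ᵥ S₁ *ᵥ Φ i = 0 ∧ Φ j ⬝ᵥ S₂ *ᵥ Φ i = 0 := by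
  -- Pair node i's equation with φ_j and node j's with φ_i; by symmetry the same two unknowns occur
  -- in both.
  have e₁ : Φ j ⬝ᵥ S₁ *ᵥ Φ i + lam i * (Φ j ⬝ᵥ S₂ *ᵥ Φ i) = 0 := by
    rw [← smul_eq_mul, ← dotProduct_smul, ← dotProduct_add, hi, dotProduct_zero]
  have e₂ : Φ j ⬝ᵥ S₁ *ᵥ Φ i + lam j * (Φ j ⬝ᵥ S₂ *ᵥ Φ i) = 0 := by
    rw [dotProduct_mulVec_comm_of_isSymm h₁, dotProduct_mulVec_comm_of_isSymm h₂,
      ← smul_eq_mul, ← dotProduct_smul, ← dotProduct_add, hj, dotProduct_zero]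
  have hne : lam i - lam j ≠ 0 := sub_ne_zero.2 fun h => hij (hlam h)
  have h0 : Φ j ⬝ᵥ S₂ *ᵥ Φ i = 0 :=
    (mul_eq_zero.1 (by linear_combination e₁ - e₂ :
      (lam i - lam j) * (Φ j ⬝ᵥ S₂ *ᵥ Φ i) = 0)).resolve_left hne
  exact ⟨by rw [h0, mul_zero, add_zero] at e₁; exact e₁, h0⟩

open Matrix in
theorem eq_zero_of_stored_eq_zero {n α : ℕ} {Φ : Matrix (Fin n) (Fin α) F} {lam : Fin n → F}
    (hΦ : AnyRowsIndependent α Φ) (hlam : Function.Injective lam)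
    {S₁ S₂ : Matrix (Fin α) (Fin α) F} (h₁ : S₁.IsSymm) (h₂ : S₂.IsSymm) {K : Finset (Fin n)}
    (hK : K.card = α + 1) (h : ∀ i ∈ K, S₁ *ᵥ Φ i + lam i • S₂ *ᵥ Φ i = 0) :
    S₁ = 0 ∧ S₂ = 0 := by
  have key : ∀ i ∈ K, S₁ *ᵥ Φ i = 0 ∧ S₂ *ᵥ Φ i = 0 := fun i hi => by
    have hcard : (K.erase i).card = α := by rw [Finset.card_erase_of_mem hi, hK]; rfl
    constructor <;> refine hΦ.eq_zero_of_dotProduct (Fintype.card_fin α) hcard fun j hj => ?_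
    all_goals
      rw [Finset.mem_erase] at hj
      have := dotProduct_mulVec_eq_zero hlam h₁ h₂ hj.1.symm (h i hi) (h j hj.2)
      rw [dotProduct_comm]
    exacts [this.1, this.2]
  obtain ⟨I, hIK, hI⟩ := Finset.exists_subset_card_eq (show α ≤ K.card by omega)
  exact ⟨eq_zero_of_mulVec_eq_zero hΦ hI fun i hi => (key i (hIK hi)).1,
    eq_zero_of_mulVec_eq_zero hΦ hI fun i hi => (key i (hIK hi)).2⟩

variable {α ℓ m : ℕ}

theorem isSymm_symmMatrix {F : Type*} (u : MessageIndex α ℓ m → F) (r : RandomIndex α ℓ m → F)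
    (s : Fin 2) : (symmMatrix u r s).IsSymm := by
  ext i j
  simp only [symmMatrix, Matrix.transpose_apply, Matrix.of_apply, Sym2.eq_swap (a := j)]

theorem symmMatrix_add (u u' : MessageIndex α ℓ m → F) (r r' : RandomIndex α ℓ m → F)
    (s : Fin 2) : symmMatrix (u + u') (r + r') s = symmMatrix u r s + symmMatrix u' r' s := by
  ext i j
  simp only [symmMatrix, Matrix.add_apply, Matrix.of_apply]
  split <;> rfl

theorem symmMatrix_smul (a : F) (u : MessageIndex α ℓ m → F) (r : RandomIndex α ℓ m → F)
    (s : Fin 2) : symmMatrix (a • u) (a • r) s = a • symmMatrix u r s := by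
  ext i j
  simp only [symmMatrix, Matrix.smul_apply, Matrix.of_apply]
  split <;> rfl

theorem symmMatrix_sub (u u' : MessageIndex α ℓ m → F) (r r' : RandomIndex α ℓ m → F)
    (s : Fin 2) : symmMatrix (u - u') (r - r') s = symmMatrix u r s - symmMatrix u' r' s := by
  rw [eq_sub_iff_add_eq, ← symmMatrix_add, sub_add_cancel, sub_add_cancel]

theorem eq_zero_of_symmMatrix_eq_zero {u : MessageIndex α ℓ m → F} {r : RandomIndex α ℓ m → F}
    (h : ∀ s, symmMatrix u r s = 0) : u = 0 ∧ r = 0 := by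
  constructor
  · ext ⟨⟨s, p⟩, hp⟩
    induction p using Sym2.ind with | _ i j =>
    simpa [symmMatrix, hp] using congrFun (congrFun (h s) i) j
  · ext ⟨⟨s, p⟩, hp⟩
    induction p using Sym2.ind with | _ i j =>
    simpa [symmMatrix, hp] using congrFun (congrFun (h s) i) j

variable {n : ℕ} (Φ : Matrix (Fin n) (Fin α) F) (lam : Fin n → F)

open Matrix in
theorem secureCode_store (u : MessageIndex α ℓ m → F) (r : RandomIndex α ℓ m → F) (i : Fin n) :
    (secureCode Φ lam ℓ m).store u r i =
      symmMatrix u r 0 *ᵥ Φ i + lam i • symmMatrix u r 1 *ᵥ Φ i := by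
  have h : (secureCode Φ lam ℓ m).store u r i =
      Φ i ᵥ* symmMatrix u r 0 + (lam i • Φ i) ᵥ* symmMatrix u r 1 := by
    ext c
    simp [secureCode, encodingMatrix, messageMatrix, Matrix.fromCols_mul_fromRows,
      Matrix.mul_apply (M := Φ), Matrix.mul_apply (N := symmMatrix u r 1), vecMul, dotProduct]
  rw [h, smul_vecMul, ← mulVec_transpose, ← mulVec_transpose, (isSymm_symmMatrix u r 0).eq,
    (isSymm_symmMatrix u r 1).eq]

theorem secureCode_store_sub (u u' : MessageIndex α ℓ m → F) (r r' : RandomIndex α ℓ m → F)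
    (i : Fin n) : (secureCode Φ lam ℓ m).store (u - u') (r - r') i =
      (secureCode Φ lam ℓ m).store u r i - (secureCode Φ lam ℓ m).store u' r' i := by
  simp only [secureCode_store, symmMatrix_sub, Matrix.sub_mulVec, smul_sub]
  abel

variable {Φ lam}

theorem secureCode_canReconstruct (h : IsAdmissible Φ lam ℓ m) :
    (secureCode Φ lam ℓ m).CanReconstruct (α + 1) := by
  intro K hK u u' r r' heq
  have h0 : ∀ i ∈ K, (secureCode Φ lam ℓ m).store (u - u') (r - r') i = 0 := fun i hi => by
    rw [secureCode_store_sub, heq i hi, sub_self]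
  simp only [secureCode_store] at h0
  obtain ⟨h₁, h₂⟩ := eq_zero_of_stored_eq_zero h.phi_rows h.lam_injective
    (isSymm_symmMatrix _ _ 0) (isSymm_symmMatrix _ _ 1) hK h0
  have := eq_zero_of_symmMatrix_eq_zero (u := u - u') (r := r - r')
    (by simp [Fin.forall_fin_two, h₁, h₂])
  exact ⟨sub_eq_zero.1 this.1, sub_eq_zero.1 this.2⟩

-- What helper i passes is the pairing of row i of `Ψ` with a vector that depends on f only. So
-- repair is a square linear system, and all repairs of f reveal no more than this vector.
open Matrix in
theorem secureCode_store_dotProduct (u : MessageIndex α ℓ m → F) (r : RandomIndex α ℓ m → F)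
    (i f : Fin n) : (secureCode Φ lam ℓ m).store u r i ⬝ᵥ Φ f =
      Sum.elim (symmMatrix u r 0 *ᵥ Φ f) (symmMatrix u r 1 *ᵥ Φ f) ⬝ᵥ encodingMatrix Φ lam i := by
  have henc : encodingMatrix Φ lam i = Sum.elim (Φ i) (lam i • Φ i) := by
    ext (c | c) <;> simp [encodingMatrix]
  rw [henc, sumElim_dotProduct_sumElim, secureCode_store, add_dotProduct, smul_dotProduct,
    dotProduct_smul, dotProduct_comm, dotProduct_comm _ (Φ f),
    dotProduct_mulVec_comm_of_isSymm (isSymm_symmMatrix u r 0),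
    dotProduct_mulVec_comm_of_isSymm (isSymm_symmMatrix u r 1), dotProduct_comm,
    dotProduct_comm (Φ i)]

theorem secureCode_canRepair (h : IsAdmissible Φ lam ℓ m) :
    (secureCode Φ lam ℓ m).CanRepair (2 * α) := by
  intro op u u' r r' heq
  have h0 := h.psi_rows.eq_zero_of_dotProduct (by simp [two_mul]) op.card_helpers
    (v := Sum.elim ((symmMatrix (u - u') (r - r') 0).mulVec (Φ op.failed))
      ((symmMatrix (u - u') (r - r') 1).mulVec (Φ op.failed))) fun j hj => by
    rw [← secureCode_store_dotProduct, secureCode_store_sub, sub_dotProduct, sub_eq_zero]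
    exact congrFun (heq j hj) 0
  have h₁ : (symmMatrix (u - u') (r - r') 0).mulVec (Φ op.failed) = 0 :=
    funext fun c => congrFun h0 (Sum.inl c)
  have h₂ : (symmMatrix (u - u') (r - r') 1).mulVec (Φ op.failed) = 0 :=
    funext fun c => congrFun h0 (Sum.inr c)
  rw [← sub_eq_zero, ← secureCode_store_sub, secureCode_store, h₁, h₂, smul_zero, add_zero]

theorem secureCode_isMSR (h : IsAdmissible Φ lam ℓ m) :
    (secureCode Φ lam ℓ m).IsMSR (α + 1) (2 * α) where
  card_input := by
    rw [add_comm, card_randomIndex_add_card_messageIndex, mul_comm]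
  repair_bandwidth := by
    rw [Nat.add_sub_cancel]
    ring
  reconstruct := secureCode_canReconstruct h
  repair := secureCode_canRepair h

/-! ### Security -/

-- The stored data of `L` control S₂φ_f only against the ℓ - 1 other nodes of `L`; the α + 1 - ℓ
-- nodes of `X` complete these to α independent functionals.
open Matrix in
theorem mulVec_eq_zero_of_observed (hΦ : AnyRowsIndependent α Φ) (hlam : Function.Injective lam)
    (hℓ : ℓ ≤ α) {L X : Finset (Fin n)} (hL : L.card = ℓ) (hX : X.card = α + 1 - ℓ)
    (hLX : Disjoint L X) {S₁ S₂ : Matrix (Fin α) (Fin α) F} (h₁ : S₁.IsSymm) (h₂ : S₂.IsSymm)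
    (hstore : ∀ i ∈ L, S₁ *ᵥ Φ i + lam i • S₂ *ᵥ Φ i = 0) {f : Fin n} (hf : f ∈ L)
    (hextra : ∀ x ∈ X, Φ x ⬝ᵥ S₂ *ᵥ Φ f = 0) : S₂ *ᵥ Φ f = 0 := by
  have hcard : (L.erase f ∪ X).card = α := by
    have : 0 < L.card := Finset.card_pos.2 ⟨f, hf⟩
    rw [Finset.card_union_of_disjoint (hLX.mono_left (Finset.erase_subset _ _)),
      Finset.card_erase_of_mem hf]
    omega
  refine hΦ.eq_zero_of_dotProduct (Fintype.card_fin α) hcard fun j hj => ?_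
  rw [dotProduct_comm]
  rcases Finset.mem_union.1 hj with hj | hj
  · rw [Finset.mem_erase] at hj
    exact (dotProduct_mulVec_eq_zero hlam h₁ h₂ hj.1.symm (hstore f hf) (hstore j hj.2)).2
  · exact hextra j hj

open Matrix in
/-- When the message part vanishes, the data stored in the nodes of `L`, together with the entries
of `S₂` that the repairs of the nodes in `D` add to it, determine the random symbols. -/
theorem eq_zero_of_observed_eq_zero (h : IsAdmissible Φ lam ℓ m) (hℓ : ℓ ≤ α) (hm : m ≤ ℓ)
    {L D X : Finset (Fin n)} (hL : L.card = ℓ) (hD : D.card = m) (hDL : D ⊆ L)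
    (hX : X.card = α + 1 - ℓ) (hLX : Disjoint L X) {S₁ S₂ : Matrix (Fin α) (Fin α) F}
    (h₁ : S₁.IsSymm) (h₂ : S₂.IsSymm)
    (hS₁ : ∀ c c', ℓ ≤ c.val → ℓ ≤ c'.val → S₁ c c' = 0)
    (hS₂ : ∀ c c', m ≤ c.val → m ≤ c'.val → (ℓ - 1 ≤ c.val ∨ ℓ - 1 ≤ c'.val) → S₂ c c' = 0)
    (hstore : ∀ i ∈ L, S₁ *ᵥ Φ i + lam i • S₂ *ᵥ Φ i = 0)
    (hextra : ∀ x ∈ X, ∀ f ∈ D, Φ x ⬝ᵥ S₂ *ᵥ Φ f = 0) : S₁ = 0 ∧ S₂ = 0 := by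
  have hf : ∀ f ∈ D, S₂ *ᵥ Φ f = 0 := fun f hf => mulVec_eq_zero_of_observed h.phi_rows
    h.lam_injective hℓ hL hX hLX h₁ h₂ hstore (hDL hf) (hextra · · f hf)
  -- Such a row is supported on the first m columns and is orthogonal to m rows of `Φ`.
  have hrow : ∀ c, m ≤ c.val → ℓ - 1 ≤ c.val → S₂ c = 0 := fun c hc hc' =>
    eq_zero_of_firstColumns (hm.trans hℓ) h.first_m hD (fun f hfD => congrFun (hf f hfD) c)
      fun c' hc'' => hS₂ c c' hc hc'' (Or.inl hc')
  have hz₂ : S₂ = 0 := by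
    -- For m = ℓ, symmetry and the m known vectors S₂φ_f suffice. For m < ℓ, `S₂` lives in its
    -- leading block of size ℓ - 1.
    rcases hm.eq_or_lt with rfl | hlt
    · funext c
      refine eq_zero_of_firstColumns hℓ h.first_m hD (fun f hfD => congrFun (hf f hfD) c)
        fun c' hc' => ?_
      rw [← h₂.apply]
      exact congrFun (hrow c' hc' (by omega)) c
    -- The diagonal value φ_iᵀS₂φ_i is not known, so only the ℓ - 1 nodes of `L` other than i give
    -- equations. This is why the random block has size ℓ - 1 and not ℓ.
    · have hi : ∀ i ∈ L, S₂ *ᵥ Φ i = 0 := fun i hi => by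
        refine eq_zero_of_firstColumns (by omega) h.first_ell_sub_one
          (by rw [Finset.card_erase_of_mem hi, hL]) (fun j hj => ?_)
          fun c hc => by simp [mulVec, hrow c (by omega) hc]
        rw [Finset.mem_erase] at hj
        rw [dotProduct_comm]
        exact (dotProduct_mulVec_eq_zero h.lam_injective h₁ h₂ hj.1.symm (hstore i hi)
          (hstore j hj.2)).2
      obtain ⟨I, hIL, hI⟩ := Finset.exists_subset_card_eq (show ℓ - 1 ≤ L.card by omega)
      funext c
      refine eq_zero_of_firstColumns (by omega) h.first_ell_sub_one hI
        (fun i hiI => congrFun (hi i (hIL hiI)) c) fun c' hc' => ?_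
      rw [← h₂.apply]
      exact congrFun (hrow c' (by omega) hc') c
  have hz₁ : ∀ i ∈ L, S₁ *ᵥ Φ i = 0 := fun i hi => by simpa [hz₂] using hstore i hi
  have hrow₁ : ∀ c, ℓ ≤ c.val → S₁ c = 0 := fun c hc =>
    eq_zero_of_firstColumns hℓ h.first_ell hL (fun i hi => congrFun (hz₁ i hi) c) (hS₁ c · hc)
  refine ⟨funext fun c => eq_zero_of_firstColumns hℓ h.first_ell hL
    (fun i hi => congrFun (hz₁ i hi) c) fun c' hc' => ?_, hz₂⟩
  rw [← h₁.apply, hrow₁ c' hc']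
  rfl

/-- The linear dependence of the observed data on the input symbols. -/
noncomputable def observation (Φ : Matrix (Fin n) (Fin α) F) (lam : Fin n → F) (ℓ m : ℕ)
    (L D X : Finset (Fin n)) :
    ((MessageIndex α ℓ m → F) × (RandomIndex α ℓ m → F)) →ₗ[F]
      (L → Fin α → F) × (X × D → F) where
  toFun p := (fun i => (symmMatrix p.1 p.2 0).mulVec (Φ i) +
      lam i • (symmMatrix p.1 p.2 1).mulVec (Φ i),
    fun q => Φ q.1 ⬝ᵥ (symmMatrix p.1 p.2 1).mulVec (Φ q.2))
  map_add' p q := by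
    ext <;> simp [symmMatrix_add, Matrix.add_mulVec, dotProduct_add]
    ring
  map_smul' a p := by
    ext <;> simp [symmMatrix_smul, Matrix.smul_mulVec, dotProduct_smul]
    ring

theorem exists_observation_eq_zero (h : IsAdmissible Φ lam ℓ m) (hℓ : ℓ ≤ α) (hm : m ≤ ℓ)
    {L D X : Finset (Fin n)} (hL : L.card = ℓ) (hD : D.card = m) (hDL : D ⊆ L)
    (hX : X.card = α + 1 - ℓ) (hLX : Disjoint L X) (u : MessageIndex α ℓ m → F) :
    ∃ r : RandomIndex α ℓ m → F, observation Φ lam ℓ m L D X (u, r) = 0 := by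
  set V := observation Φ lam ℓ m L D X ∘ₗ LinearMap.inr F _ _
  have hinj : Function.Injective V := by
    rw [← LinearMap.ker_eq_bot, LinearMap.ker_eq_bot']
    intro r hr
    have hr' : observation Φ lam ℓ m L D X (0, r) = 0 := hr
    obtain ⟨h₁, h₂⟩ := eq_zero_of_observed_eq_zero h hℓ hm hL hD hDL hX hLX
      (isSymm_symmMatrix 0 r 0) (isSymm_symmMatrix 0 r 1)
      (fun c c' hc hc' => by
        rw [symmMatrix, Matrix.of_apply, dif_neg]
        · rfl
        · simp [randomPositions]; omega)
      (fun c c' hc hc' hcc => by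
        rw [symmMatrix, Matrix.of_apply, dif_neg]
        · rfl
        · simp [randomPositions]; omega)
      (fun i hi => congrFun (congrArg Prod.fst hr') ⟨i, hi⟩)
      (fun x hx f hf => congrFun (congrArg Prod.snd hr') (⟨x, hx⟩, ⟨f, hf⟩))
    exact (eq_zero_of_symmMatrix_eq_zero (u := 0) (r := r)
      (by simp [Fin.forall_fin_two, h₁, h₂])).2
  -- The observed coordinates number ℓα + (α + 1 - ℓ)m, the number of random symbols.
  have hsurj : Function.Surjective V :=
    (LinearMap.injective_iff_surjective_of_finrank_eq_finrank (by
      rw [Module.finrank_pi, card_randomIndex hℓ hm]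
      simp [Module.finrank_pi_fintype, hL, hD, hX])).1 hinj
  obtain ⟨r, hr⟩ := hsurj (-observation Φ lam ℓ m L D X (u, 0))
  refine ⟨r, ?_⟩
  have : (u, r) = (u, 0) + ((0, r) : (MessageIndex α ℓ m → F) × (RandomIndex α ℓ m → F)) := by
    simp
  rw [this, map_add]
  exact add_eq_zero_iff_neg_eq.2 hr.symm

/-- Every message is compatible with the all-zero view. -/
theorem exists_view_eq_zero (h : IsAdmissible Φ lam ℓ m) (hn : 2 * α < n) (hℓ : ℓ ≤ α)
    (hm : m ≤ ℓ) {d : ℕ} (E : Eavesdropper n d ℓ m) (u : MessageIndex α ℓ m → F) :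
    ∃ r : RandomIndex α ℓ m → F,
      (∀ i ∈ E.stored, (secureCode Φ lam ℓ m).store u r i = 0) ∧
      ∀ f ∈ E.repaired, ∀ j, (secureCode Φ lam ℓ m).store u r j ⬝ᵥ Φ f = 0 := by
  -- Enlarge the eavesdropper to exactly ℓ stored and m repaired nodes, so that the system becomes
  -- square.
  obtain ⟨L, hEL, hL⟩ := Finset.exists_superset_card_eq E.card_stored
    (show ℓ ≤ Fintype.card (Fin n) by rw [Fintype.card_fin]; omega)
  obtain ⟨D, hED, hDL, hD⟩ := Finset.exists_subsuperset_card_eq (E.repaired_subset.trans hEL)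
    E.card_repaired (hm.trans hL.ge)
  obtain ⟨X, hXL, hX⟩ := Finset.exists_subset_card_eq (s := Lᶜ) (n := α + 1 - ℓ) (by
    rw [Finset.card_compl, Fintype.card_fin]; omega)
  have hLX : Disjoint L X := Finset.disjoint_left.2 fun i hi hiX => Finset.mem_compl.1 (hXL hiX) hi
  obtain ⟨r, hr⟩ := exists_observation_eq_zero h hℓ hm hL hD hDL hX hLX u
  have hstore : ∀ i ∈ L, (symmMatrix u r 0).mulVec (Φ i) +
      lam i • (symmMatrix u r 1).mulVec (Φ i) = 0 :=
    fun i hi => congrFun (congrArg Prod.fst hr) ⟨i, hi⟩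
  refine ⟨r, fun i hi => by rw [secureCode_store, hstore i (hEL hi)], fun f hf j => ?_⟩
  have hfL := hDL (hED hf)
  have h₂ := mulVec_eq_zero_of_observed h.phi_rows h.lam_injective hℓ hL hX hLX
    (isSymm_symmMatrix u r 0) (isSymm_symmMatrix u r 1) hstore hfL
    fun x hx => congrFun (congrArg Prod.snd hr) (⟨x, hx⟩, ⟨f, hED hf⟩)
  have h₁ := hstore f hfL
  rw [h₂, smul_zero, add_zero] at h₁
  rw [secureCode_store_dotProduct, h₁, h₂]
  simp [dotProduct]

end Code

/-! ### Vanishing of the mutual information -/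

section Probability

variable {A ρ : Type*} [Fintype A] [Fintype ρ] [MeasurableSpace A] [DiscreteMeasurableSpace A]

theorem uniformOn_univ_singleton (a : A) :
    uniformOn (Set.univ : Set A) {a} = (Fintype.card A : ENNReal)⁻¹ := by
  simp [uniformOn_univ]

theorem pi_uniformOn_singleton (r : ρ → A) :
    (Measure.pi fun _ : ρ => uniformOn (Set.univ : Set A)) {r} =
      (Fintype.card A : ENNReal)⁻¹ ^ Fintype.card ρ := by
  simp [Measure.pi_singleton, uniformOn_univ_singleton]

theorem pi_uniformOn_map_perm (σ : Equiv.Perm (ρ → A)) :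
    (Measure.pi fun _ : ρ => uniformOn (Set.univ : Set A)).map σ =
      Measure.pi fun _ : ρ => uniformOn (Set.univ : Set A) := by
  refine Measure.ext_iff_singleton.2 fun r => ?_
  rw [Measure.map_apply (measurable_of_countable _) (measurableSet_singleton r),
    ← σ.image_symm_eq_preimage, Set.image_singleton, pi_uniformOn_singleton,
    pi_uniformOn_singleton]

variable [Nonempty A]

instance : IsProbabilityMeasure (uniformOn (Set.univ : Set A)) :=
  isProbabilityMeasure_uniformOn Set.finite_univ Set.univ_nonempty

/-- Permutations preserve the uniform law, so the skew map (u, r) ↦ (u, σ_u r) preserves the joint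
law of message and randomness. It replaces the view by one in which u no longer occurs, and the
joint law of message and view becomes a product. -/
theorem isSecure_of_perm {ι : Type*} [Finite ι] {n α β d ℓ m : ℕ} {C : StorageCode A ι ρ n α β}
    (u₀ : ι → A) (h : ∀ (E : Eavesdropper n d ℓ m) (u : ι → A), ∃ σ : Equiv.Perm (ρ → A),
      ∀ r, C.view E u r = C.view E u₀ (σ r)) : C.IsSecure d ℓ m := by
  intro ν hν E
  choose σ hσ using h E
  set P := Measure.pi fun _ : ρ => uniformOn (Set.univ : Set A)
  have hjoint : (ν.prod P).map (fun ω => (ω.1, C.view E ω.1 ω.2)) =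
      ν.prod (P.map (C.view E u₀)) := by
    have hpres : MeasurePreserving (fun p : (ι → A) × (ρ → A) => (p.1, σ p.1 p.2))
        (ν.prod P) (ν.prod P) :=
      (MeasurePreserving.id ν).skew_product (g := fun u r => σ u r) (measurable_of_countable _)
        (Filter.Eventually.of_forall fun u => pi_uniformOn_map_perm (σ u))
    have hmap := Measure.map_prod_map ν P measurable_id
      (measurable_of_countable (C.view E u₀))
    rw [Measure.map_id] at hmap
    rw [hmap]
    conv_rhs => rw [← hpres.map_eq]
    rw [Measure.map_map (measurable_of_countable _) (measurable_of_countable _)]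
    congr 1
    ext1 ω
    exact Prod.ext rfl (hσ ω.1 ω.2)
  have hsnd : (ν.prod P).map (fun ω => C.view E ω.1 ω.2) = P.map (C.view E u₀) := by
    have := congrArg (Measure.map Prod.snd) hjoint
    rwa [Measure.map_map measurable_snd (measurable_of_countable _), Measure.map_snd_prod,
      measure_univ, one_smul] at this
  have hfst : (ν.prod P).map (fun ω => ω.1) = ν := by
    rw [Measure.map_fst_prod, measure_univ, one_smul]
  have : IsProbabilityMeasure (P.map (C.view E u₀)) :=
    Measure.isProbabilityMeasure_map (measurable_of_countable _).aemeasurable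
  rw [mutualInformation, hjoint, hsnd, hfst]
  exact InformationTheory.klDiv_self _

theorem map_singleton_ne_zero {Ω Y : Type*} [Countable Ω] [MeasurableSpace Ω]
    [MeasurableSingletonClass Ω] [MeasurableSpace Y] [MeasurableSingletonClass Y] {μ : Measure Ω}
    (hμ : ∀ ω, μ {ω} ≠ 0) (g : Ω → Y) (ω : Ω) : μ.map g {g ω} ≠ 0 := fun h0 => by
  rw [Measure.map_apply (measurable_of_countable _) (measurableSet_singleton _)] at h0
  exact hμ ω (measure_mono_null (by simp) h0)

/-- In a secure code every view can arise from every message. -/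
theorem StorageCode.IsSecure.exists_view_eq {ι : Type*} [Fintype ι] {n α β d ℓ m : ℕ}
    {C : StorageCode A ι ρ n α β} (hC : C.IsSecure d ℓ m) (E : Eavesdropper n d ℓ m)
    (u u' : ι → A) (r' : ρ → A) : ∃ r, C.view E u r = C.view E u' r' := by
  set P := Measure.pi fun _ : ρ => uniformOn (Set.univ : Set A)
  -- A message law of full support: the product of the marginals then charges every pair of a
  -- message and an attainable view, and so must the joint law.
  set ν := Measure.pi fun _ : ι => uniformOn (Set.univ : Set A)
  have hsingle : ∀ ω, (ν.prod P) {ω} ≠ 0 := fun ω => by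
    rw [← Set.singleton_prod_singleton, Measure.prod_prod, pi_uniformOn_singleton,
      pi_uniformOn_singleton]
    simp
  have hkl := hC ν E
  rw [mutualInformation, InformationTheory.klDiv_eq_zero_iff] at hkl
  have heq := congrArg (fun μ => μ {(u, C.view E u' r')}) hkl
  by_contra! hne
  simp only [← Set.singleton_prod_singleton, Measure.prod_prod] at heq
  have hempty : (fun ω : (ι → A) × (ρ → A) => (ω.1, C.view E ω.1 ω.2)) ⁻¹'
      {(u, C.view E u' r')} = ∅ := Set.eq_empty_of_forall_notMem fun ω hω => by
    simp only [Set.mem_preimage, Set.mem_singleton_iff, Prod.mk.injEq] at hω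
    exact hne ω.2 (hω.1 ▸ hω.2)
  rw [Set.singleton_prod_singleton, Measure.map_apply (measurable_of_countable _)
    (measurableSet_singleton _), hempty, measure_empty] at heq
  exact mul_ne_zero (map_singleton_ne_zero hsingle Prod.fst (u, r'))
    (map_singleton_ne_zero hsingle (fun ω => C.view E ω.1 ω.2) (u', r')) heq.symm

end Probability

/-! ### Security of the product-matrix code. -/

section

variable {F : Type*} [Field F] [Fintype F] [MeasurableSpace F] [DiscreteMeasurableSpace F]

theorem secureCode_isSecure {n α ℓ m d : ℕ} {Φ : Matrix (Fin n) (Fin α) F} {lam : Fin n → F}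
    (h : IsAdmissible Φ lam ℓ m) (hn : 2 * α < n) (hℓ : ℓ ≤ α) (hm : m ≤ ℓ) :
    (secureCode Φ lam ℓ m).IsSecure d ℓ m := by
  refine isSecure_of_perm 0 fun E u => ?_
  obtain ⟨r₀, hstored, hrepair⟩ := exists_view_eq_zero h hn hℓ hm E u
  -- The pair (u, r₀) has zero view, so by linearity (u, r) and (0, r - r₀) have the same view.
  refine ⟨Equiv.subRight r₀, fun r => ?_⟩
  have hsub : ∀ i, (secureCode Φ lam ℓ m).store 0 (r - r₀) i =
      (secureCode Φ lam ℓ m).store u r i - (secureCode Φ lam ℓ m).store u r₀ i := fun i => by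
    rw [← secureCode_store_sub, sub_self]
  refine Prod.ext (funext fun i => ?_) (funext fun t => funext fun j => funext fun _ => ?_)
  · change _ = (secureCode Φ lam ℓ m).store 0 (r - r₀) i
    rw [hsub, hstored i i.2, sub_zero]
    rfl
  · change (secureCode Φ lam ℓ m).store u r j ⬝ᵥ Φ (E.op t).failed =
      (secureCode Φ lam ℓ m).store 0 (r - r₀) j ⬝ᵥ Φ (E.op t).failed
    rw [hsub, sub_dotProduct, hrepair _ (E.op_failed_mem t), sub_zero]

end

/-! ### The upper bound on the number of message symbols -/

section Bound

variable {A ι ρ : Type*} [Fintype A] [Fintype ι] [Fintype ρ] {n α β k d : ℕ}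
  {C : StorageCode A ι ρ n α β}

/-- The data stored in any `k` nodes of an MSR code can be prescribed. -/
theorem StorageCode.IsMSR.exists_store_eq (hC : C.IsMSR k d) {K : Finset (Fin n)} (hK : K.card = k)
    (x : Fin n → Fin α → A) : ∃ u r, ∀ i ∈ K, C.store u r i = x i := by
  classical
  let g : (ι → A) × (ρ → A) → K → Fin α → A := fun p i => C.store p.1 p.2 i
  have hinj : Function.Injective g := fun p q h =>
    Prod.ext_iff.2 (hC.reconstruct K hK _ _ _ _ fun i hi => congrFun h ⟨i, hi⟩)
  -- Reconstruction is injectivity, and both sides have |A|^(kα) elements.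
  have hbij := (Fintype.bijective_iff_injective_and_card g).2 ⟨hinj, by
    simp only [Fintype.card_prod, Fintype.card_fun, Fintype.card_coe, Fintype.card_fin, hK]
    rw [← pow_add, hC.card_input, ← pow_mul, mul_comm]⟩
  obtain ⟨p, hp⟩ := hbij.2 fun i => x i
  exact ⟨p.1, p.2, fun i hi => congrFun hp ⟨i, hi⟩⟩

variable [Nonempty A]

/-- At most `|A| ^ ((d - k) * β)` contents of a helper are compatible with the symbols that it
passes. -/
theorem StorageCode.IsMSR.card_fiber_send_le [DecidableEq A] (hC : C.IsMSR k d) (hk : 1 ≤ k) (hkd : k ≤ d)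
    (op : RepairOp n d) {j : Fin n} (hj : j ∈ op.helpers) (s : Fin β → A) :
    Fintype.card {x : Fin α → A // C.send op.failed op.helpers j x = s} ≤
      Fintype.card A ^ ((d - k) * β) := by
  classical
  obtain ⟨G, hGH, hG⟩ := Finset.exists_subset_card_eq (s := op.helpers.erase j) (n := k - 1)
    (by rw [Finset.card_erase_of_mem hj, op.card_helpers]; omega)
  have hjG : j ∉ G := fun h => by simpa using hGH h
  have hfG : op.failed ∉ G := fun h => op.failed_notMem (Finset.mem_of_mem_erase (hGH h))
  let x₀ : Fin α → A := fun _ => Classical.arbitrary A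
  -- Freeze k - 1 other helpers and let the content x of j vary.
  have hex : ∀ x : Fin α → A, ∃ u r, C.store u r j = x ∧ ∀ i ∈ G, C.store u r i = x₀ := by
    intro x
    obtain ⟨u, r, h⟩ := hC.exists_store_eq (K := insert j G)
      (by rw [Finset.card_insert_of_notMem hjG]; omega) (Function.update (fun _ => x₀) j x)
    refine ⟨u, r, by simpa using h j (by simp), fun i hi => ?_⟩
    rw [h i (by simp [hi]), Function.update_of_ne (ne_of_mem_of_not_mem hi hjG)]
  choose u r hj_eq hG_eq using hex
  let Q := op.helpers.erase j \ G
  have hQ : Q.card = d - k := by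
    rw [Finset.card_sdiff_of_subset hGH, Finset.card_erase_of_mem hj, op.card_helpers]
    omega
  let φ : {x : Fin α → A // C.send op.failed op.helpers j x = s} → Q → Fin β → A :=
    fun x i => C.send op.failed op.helpers i (C.store (u x) (r x) i)
  -- On the fibre, only the d - k helpers in `Q` can vary what they pass. Their symbols determine
  -- the failed node, which together with `G` makes k nodes and so determines x.
  have hφ : Function.Injective φ := fun x y hxy => by
    have hf : C.store (u x) (r x) op.failed = C.store (u y) (r y) op.failed := by
      refine hC.repair op _ _ _ _ fun i hi => ?_
      by_cases hij : i = j
      · rw [hij, hj_eq, hj_eq, x.2, y.2]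
      by_cases hiG : i ∈ G
      · rw [hG_eq _ i hiG, hG_eq _ i hiG]
      · exact congrFun hxy ⟨i, by simp [Q, hi, hij, hiG]⟩
    obtain ⟨hu, hr⟩ := hC.reconstruct (insert op.failed G)
      (by rw [Finset.card_insert_of_notMem hfG]; omega) _ _ _ _ fun i hi => by
        rcases Finset.mem_insert.1 hi with rfl | hi
        · exact hf
        · rw [hG_eq _ i hi, hG_eq _ i hi]
    exact Subtype.ext (by rw [← hj_eq x, ← hj_eq y, hu, hr])
  refine (Fintype.card_le_of_injective φ hφ).trans_eq ?_
  simp only [Fintype.card_fun, Fintype.card_coe, Fintype.card_fin, hQ]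
  rw [← pow_mul, mul_comm]

variable [MeasurableSpace A] [DiscreteMeasurableSpace A] {ℓ m : ℕ}

/-- If, given the view of the eavesdropper, each of the remaining nodes of `K` has at most
`|A| ^ t` possible contents, then there are at most `(|K| - |stored nodes|) * t` message
symbols. -/
theorem card_message_le_of_view (hA : 1 < Fintype.card A) (hC : C.CanReconstruct k)
    (hS : C.IsSecure d ℓ m) (E : Eavesdropper n d ℓ m) {K : Finset (Fin n)} (hK : K.card = k)
    (hEK : E.stored ⊆ K) (u₀ : ι → A) (r₀ : ρ → A) (T : Fin n → Finset (Fin α → A)) (t : ℕ)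
    (hT : ∀ i ∈ K \ E.stored, (T i).card ≤ Fintype.card A ^ t)
    (hview : ∀ u r, C.view E u r = C.view E u₀ r₀ → ∀ i ∈ K \ E.stored, C.store u r i ∈ T i) :
    Fintype.card ι ≤ (k - E.stored.card) * t := by
  classical
  -- Each message gets randomness producing the same view; the nodes of `K` outside the
  -- eavesdropper's reach must then tell the messages apart.
  choose r hr using fun u => hS.exists_view_eq E u u₀ r₀
  let φ : (ι → A) → (i : (K \ E.stored : Finset (Fin n))) → T i :=
    fun u i => ⟨C.store u (r u) i, hview _ _ (hr u) i i.2⟩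
  have hφ : Function.Injective φ := fun u u' h => by
    refine (hC K hK u u' (r u) (r u') fun i hi => ?_).1
    by_cases hiE : i ∈ E.stored
    · exact congrFun (congrArg Prod.fst ((hr u).trans (hr u').symm)) ⟨i, hiE⟩
    · exact congrArg Subtype.val (congrFun h ⟨i, Finset.mem_sdiff.2 ⟨hi, hiE⟩⟩)
  have hle := Fintype.card_le_of_injective φ hφ
  rw [Fintype.card_fun, Fintype.card_pi] at hle
  have hprod : ∏ i : (K \ E.stored : Finset (Fin n)), Fintype.card (T i) ≤
      Fintype.card A ^ ((k - E.stored.card) * t) := by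
    refine (Finset.prod_le_prod' fun i _ => ?_).trans_eq
      (b := ∏ _i : (K \ E.stored : Finset (Fin n)), Fintype.card A ^ t) ?_
    · rw [Fintype.card_coe]
      exact hT i i.2
    · rw [Finset.prod_const, Finset.card_univ, Fintype.card_coe,
        Finset.card_sdiff_of_subset hEK, hK, ← pow_mul, mul_comm]
  exact (Nat.pow_le_pow_iff_right hA).1 (hle.trans hprod)

theorem card_message_le (hA : 1 < Fintype.card A) (hk : 2 ≤ k) (hn : 2 * k - 2 < n) (hℓ : ℓ < k)
    (hm : m ≤ ℓ) (hm1 : m ≤ 1) (hC : C.IsMSR k (2 * k - 2)) (hS : C.IsSecure (2 * k - 2) ℓ m) :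
    Fintype.card ι ≤ (k - ℓ) * (α - m * β) := by
  classical
  have hα : α = (k - 1) * β := by
    have := hC.repair_bandwidth
    rw [show 2 * k - 2 = (k - 1) + (k - 1) by omega, add_mul] at this
    omega
  obtain ⟨K, -, hK⟩ := Finset.exists_subset_card_eq (s := (Finset.univ : Finset (Fin n))) (n := k)
    (by rw [Finset.card_univ, Fintype.card_fin]; omega)
  obtain ⟨L, hLK, hL⟩ := Finset.exists_subset_card_eq (show ℓ ≤ K.card by omega)
  let u₀ : ι → A := fun _ => Classical.arbitrary A
  let r₀ : ρ → A := fun _ => Classical.arbitrary A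
  interval_cases m
  · let E : Eavesdropper n (2 * k - 2) ℓ 0 := ⟨L, hL.le, ∅, by simp, by simp, 0, Fin.elim0,
      fun t => t.elim0⟩
    have := card_message_le_of_view hA hC.reconstruct hS E hK hLK u₀ r₀ (fun _ => Finset.univ) α
      (fun i _ => by simp) (by simp)
    simpa [E, hL] using this
  · obtain ⟨f, hf⟩ : L.Nonempty := Finset.card_pos.1 (by omega)
    -- One repair of f in which every unread node of `K` helps, so the view contains β symbols from
    -- each of them.
    obtain ⟨H, hKH, hHf, hH⟩ := Finset.exists_subsuperset_card_eq (s := K \ L)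
      (t := Finset.univ.erase f) (n := 2 * k - 2)
      (fun i hi => by
        rw [Finset.mem_sdiff] at hi
        exact Finset.mem_erase.2 ⟨fun e => hi.2 (e ▸ hf), Finset.mem_univ _⟩)
      (by rw [Finset.card_sdiff_of_subset hLK]; omega)
      (by rw [Finset.card_erase_of_mem (Finset.mem_univ _), Finset.card_univ, Fintype.card_fin]
          omega)
    let op : RepairOp n (2 * k - 2) := ⟨f, H, hH, fun h => by simpa using hHf h⟩
    let E : Eavesdropper n (2 * k - 2) ℓ 1 := ⟨L, hL.le, {f}, by simpa using hf, by simp, 1,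
      fun _ => op, fun _ => by simp [op]⟩
    have := card_message_le_of_view hA hC.reconstruct hS E hK hLK u₀ r₀
      (fun i => Finset.univ.filter fun x => C.send f H i x = C.send f H i (C.store u₀ r₀ i))
      ((2 * k - 2 - k) * β)
      (fun i hi => by
        rw [← Fintype.card_subtype]
        exact hC.card_fiber_send_le (by omega) (by omega) op (hKH hi) _)
      (fun u r h i hi => by
        simp only [Finset.mem_filter, Finset.mem_univ, true_and]
        exact congrFun (congrFun (congrArg Prod.snd h) 0) ⟨i, hKH hi⟩)
    -- The fibre exponent d - k = k - 2 matches because α = (k - 1)β.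
    have hαβ : α - 1 * β = (2 * k - 2 - k) * β := by
      rw [hα, ← Nat.sub_mul]
      congr 1
      omega
    rw [hαβ, ← hL]
    exact this

end Bound

end SecureMSR

theorem mainTheorem7 {F : Type*} [Field F] [Fintype F]
    [MeasurableSpace F] [DiscreteMeasurableSpace F]
    (n k ℓ m : ℕ) (hk : 2 ≤ k) (hn : 2 * k - 2 < n) (hℓ : ℓ < k) (hm : m ≤ ℓ) :
    -- the numbers of random symbols and of message symbols
    Fintype.card (SecureMSR.RandomIndex (k - 1) ℓ m) = ℓ * (k - 1) + (k - ℓ) * m ∧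
    Fintype.card (SecureMSR.MessageIndex (k - 1) ℓ m) = (k - ℓ) * (k - 1 - m) ∧
    -- every admissible choice of the encoding matrix gives a secure MSR code
    (∀ (Φ : Matrix (Fin n) (Fin (k - 1)) F) (lam : Fin n → F),
      SecureMSR.IsAdmissible Φ lam ℓ m →
        (SecureMSR.secureCode Φ lam ℓ m).IsMSR k (2 * k - 2) ∧
        (SecureMSR.secureCode Φ lam ℓ m).IsSecure (2 * k - 2) ℓ m) ∧
    -- Vandermonde matrices are admissible
    (∀ x : Fin n → F, (∀ i j, i ≠ j → x i ^ (k - 1) ≠ x j ^ (k - 1)) →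
      SecureMSR.IsAdmissible (Matrix.of fun i (c : Fin (k - 1)) => x i ^ (c : ℕ))
        (fun i => x i ^ (k - 1)) ℓ m) ∧
    -- for `m ≤ 1`, no secure MSR code stores more message symbols
    (m ≤ 1 → ∀ (α β B R : ℕ) (C : SecureMSR.StorageCode F (Fin B) (Fin R) n α β),
      C.IsMSR k (2 * k - 2) → C.IsSecure (2 * k - 2) ℓ m → B ≤ (k - ℓ) * (α - m * β)) := by
  obtain ⟨α, rfl⟩ : ∃ α, k = α + 1 := ⟨k - 1, by omega⟩
  have hd : 2 * (α + 1) - 2 = 2 * α := by omega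
  rw [hd] at hn
  refine ⟨SecureMSR.card_randomIndex (Nat.lt_succ_iff.1 hℓ) hm,
    SecureMSR.card_messageIndex (Nat.lt_succ_iff.1 hℓ) hm, fun Φ lam h => ?_,
    fun x hx => SecureMSR.isAdmissible_vandermonde (Nat.lt_succ_iff.1 hℓ) hm hx,
    fun hm1 a b B R C hC hS => ?_⟩
  · rw [hd]
    exact ⟨SecureMSR.secureCode_isMSR h,
      SecureMSR.secureCode_isSecure h hn (Nat.lt_succ_iff.1 hℓ) hm⟩
  · rw [← Fintype.card_fin B]
    exact SecureMSR.card_message_le Fintype.one_lt_card hk (hd ▸ hn) hℓ hm hm1 hC hS
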